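/- Let $\Omega=\bigcup_{i\in I}(\alpha_i,\beta_i)\subsetneq\mathbb R$ be a finite union of pairwise disjoint nonempty open intervals, $-\infty\le\alpha_i<\beta_i\le\infty$, exactly one of which is unbounded (so the unbounded one is a half-line). Let $D=\frac1{2\pi i}\frac{d}{dx}$ be the operator in $L^2(\Omega)$ with domain $C_0^\infty(\Omega)$. Then: (i) there is no self-adjoint operator $H$ in $L^2(\Omega)$ that extends $D$; (ii) there is no strongly continuous unitary representation $\{U(t)\}_{t\in\mathbb R}$ of $\mathbb R$ on $L^2(\Omega)$ with the integrability property, that is, such that for every $x\in\Omega$, every neighborhood $V\subset\Omega$ of $x$ and every $\epsilon>0$ with $V+t\subset\Omega$ for all $|t|<\epsilon$, one has $(U(t)f)(y)=f(y+t)$ for almost every $y\in V$, for all $|t|<\epsilon$ and all $f\in L^2(\Omega)$. -/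

import Mathlib

open MeasureTheory TopologicalSpace Topology
open scoped Distributions

noncomputable section

/-- The open interval `(a, b)` of the real line, with endpoints `-∞ ≤ a` and `b ≤ +∞`. -/
def openInterval (a b : EReal) : Opens ℝ :=
  ⟨{x : ℝ | a < (x : EReal) ∧ (x : EReal) < b},
    (isOpen_lt continuous_const continuous_coe_real_ereal).inter
      (isOpen_lt continuous_coe_real_ereal continuous_const)⟩

/-- The open set `⋃ i, (α i, β i)`. -/
def unionIntervals {ι : Type*} (α β : ι → EReal) : Opens ℝ :=
  ⨆ i, openInterval (α i) (β i)

/-- The Hilbert space `L²(Ω)` of complex-valued functions, with respect to Lebesgue measure. -/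
abbrev L2 (Ω : Opens ℝ) : Type :=
  Lp ℂ 2 (volume.restrict (Ω : Set ℝ))

/-- `f(x) = (1 / 2πi) φ'(x)`. -/
def diffFun (φ : ℝ → ℂ) (x : ℝ) : ℂ :=
  (1 / (2 * (Real.pi : ℂ) * Complex.I)) * deriv φ x

theorem memLp_testFunction {Ω : Opens ℝ} (φ : 𝓓(Ω, ℂ)) :
    MemLp (φ : ℝ → ℂ) 2 (volume.restrict (Ω : Set ℝ)) :=
  φ.continuous.memLp_of_hasCompactSupport φ.hasCompactSupport

theorem differentiable_testFunction {Ω : Opens ℝ} (φ : 𝓓(Ω, ℂ)) :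
    Differentiable ℝ (φ : ℝ → ℂ) :=
  φ.contDiff.differentiable (by simp)

theorem memLp_diffFun {Ω : Opens ℝ} (φ : 𝓓(Ω, ℂ)) :
    MemLp (diffFun φ) 2 (volume.restrict (Ω : Set ℝ)) := by
  have h : Continuous (deriv (φ : ℝ → ℂ)) := φ.contDiff.continuous_deriv (by simp)
  exact (h.memLp_of_hasCompactSupport φ.hasCompactSupport.deriv).const_mul _

/-- The inclusion of `C₀^∞(Ω)` into `L²(Ω)`. -/
def testToL2 (Ω : Opens ℝ) : 𝓓(Ω, ℂ) →ₗ[ℂ] L2 Ω where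
  toFun φ := (memLp_testFunction φ).toLp φ
  map_add' φ ψ := (memLp_testFunction φ).toLp_add (memLp_testFunction ψ)
  map_smul' c φ := (memLp_testFunction φ).toLp_const_smul c

/-- The map `φ ↦ (1 / 2πi) φ'` from `C₀^∞(Ω)` to `L²(Ω)`. -/
def diffTest (Ω : Opens ℝ) : 𝓓(Ω, ℂ) →ₗ[ℂ] L2 Ω where
  toFun φ := (memLp_diffFun φ).toLp (diffFun φ)
  map_add' φ ψ := by
    rw [← MemLp.toLp_add]
    congr 1
    funext x
    have := deriv_add (differentiable_testFunction φ x) (differentiable_testFunction ψ x)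
    simp only [diffFun, Pi.add_apply, FunLike.coe_add, this]
    ring
  map_smul' c φ := by
    rw [RingHom.id_apply, ← MemLp.toLp_const_smul]
    congr 1
    funext x
    have := deriv_const_smul c (differentiable_testFunction φ x)
    simp only [diffFun, Pi.smul_apply, FunLike.coe_smul, this, smul_eq_mul]
    ring

theorem testToL2_injective (Ω : Opens ℝ) : Function.Injective (testToL2 Ω) := by
  intro φ ψ h
  have h1 : (φ : ℝ → ℂ) =ᵐ[volume.restrict (Ω : Set ℝ)] ψ :=
    (MemLp.toLp_eq_toLp_iff (memLp_testFunction φ) (memLp_testFunction ψ)).1 h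
  have h2 := Measure.eqOn_open_of_ae_eq h1 Ω.isOpen φ.continuous.continuousOn
    ψ.continuous.continuousOn
  ext x
  by_cases hx : x ∈ (Ω : Set ℝ)
  · exact h2 hx
  · rw [image_eq_zero_of_notMem_tsupport fun h => hx (φ.tsupport_subset h),
      image_eq_zero_of_notMem_tsupport fun h => hx (ψ.tsupport_subset h)]

/-- The densely defined operator `D = (1 / 2πi) d/dx` in `L²(Ω)`, with domain `C₀^∞(Ω)`. -/
def opD (Ω : Opens ℝ) : L2 Ω →ₗ.[ℂ] L2 Ω where
  domain := LinearMap.range (testToL2 Ω)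
  toFun := diffTest Ω ∘ₗ
    (LinearEquiv.ofInjective (testToL2 Ω) (testToL2_injective Ω)).symm.toLinearMap

theorem opD_apply (Ω : Opens ℝ) (φ : 𝓓(Ω, ℂ)) :
    opD Ω ⟨testToL2 Ω φ, LinearMap.mem_range_self _ φ⟩ = diffTest Ω φ := by
  change diffTest Ω ((LinearEquiv.ofInjective (testToL2 Ω) (testToL2_injective Ω)).symm
    ⟨testToL2 Ω φ, _⟩) = _
  congr 1
  rw [LinearEquiv.symm_apply_eq]
  rfl

/-- `H` is a self-adjoint extension of `D` on `Ω`. -/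
def IsSelfAdjointExtension (Ω : Opens ℝ) (H : L2 Ω →ₗ.[ℂ] L2 Ω) : Prop :=
  opD Ω ≤ H ∧ IsSelfAdjoint H

/-- A strongly continuous unitary representation of `ℝ` on `L²(Ω)`. -/
structure IsUnitaryGroup {Ω : Opens ℝ} (U : ℝ → (L2 Ω ≃ₗᵢ[ℂ] L2 Ω)) : Prop where
  map_zero : ∀ f, U 0 f = f
  map_add : ∀ s t f, U (s + t) f = U s (U t f)
  continuous : ∀ f, Continuous fun t => U t f

/-- The integrability property: whenever `V ⊆ Ω` is a neighborhood of a point of `Ω` with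
`V + t ⊆ Ω` for all `|t| < ε`, then `(U(t) f)(y) = f(y + t)` for (almost) all `y ∈ V` and all
`|t| < ε`. Elements of `L²(Ω)` being classes of functions, the equality is one almost everywhere;
the points `y` and `y + t` lie in `Ω`, so it does not depend on the representatives. -/
def HasIntegrabilityProperty {Ω : Opens ℝ} (U : ℝ → (L2 Ω ≃ₗᵢ[ℂ] L2 Ω)) : Prop :=
  ∀ x ∈ Ω, ∀ V : Set ℝ, V ⊆ Ω → V ∈ 𝓝 x →
    ∀ ε > 0, (∀ t : ℝ, ‖t‖ < ε → ∀ y ∈ V, y + t ∈ Ω) →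
      ∀ t : ℝ, ‖t‖ < ε → ∀ f : L2 Ω, ∀ᵐ y : ℝ, y ∈ V → (U t f : ℝ → ℂ) y = (f : ℝ → ℂ) (y + t)

end

/-! Let n be the number of intervals. A vector u is orthogonal to the range of D + is on test
functions exactly when u' = -2πs u weakly, so u is a multiple of e^{-2πsx} on each interval. On a
bounded interval this is square integrable for either sign of s; on the half-line it is so only for
the sign s = τ that makes it decay at infinity. Hence the deficiency spaces for τ and -τ have
different dimensions, n and n - 1.

If H is a symmetric extension of D with H + iτ surjective, the Cayley transform (H - iτ)(H + iτ)⁻¹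
maps the first space injectively into the second (`exists_cayley`). But the n truncated exponentials
give dimension at least n on one side (`toLp_indicator_exp_mem_orthogonal`), and on the other side
the half-line contributes nothing (`inner_testToL2_eq_zero_of_halfLine`), leaving at most n - 1.
This contradiction is `not_surjective_shift_of_isFormalAdjoint`.

Both claims reduce to it. A self-adjoint H has H + iτ surjective. For a unitary group, the generator
is symmetric, a Laplace transform of the group inverts generator + iτ, and the integrability
property makes the generator extend D; self-adjointness of the generator is never needed. -/

noncomputable section

/-! ### Symmetric operators, the Cayley transform and the range of H + is -/

section SymmetricOperators

variable {E : Type*} [NormedAddCommGroup E] [InnerProductSpace ℂ E]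

namespace LinearPMap

/-- By symmetry the cross terms cancel. The right side is even in s, which is why the Cayley
transform is isometric. -/
theorem inner_add_I_smul {H : E →ₗ.[ℂ] E} (hH : H.IsFormalAdjoint H) (s : ℝ) (x y : H.domain) :
    inner ℂ (H x + (Complex.I * s) • (x : E)) (H y + (Complex.I * s) • (y : E)) =
      inner ℂ (H x) (H y) + (s : ℂ) ^ 2 * inner ℂ (x : E) (y : E) := by
  have h := hH x y
  simp only [inner_add_left, inner_add_right, inner_smul_left, inner_smul_right, map_mul,
    Complex.conj_I, Complex.conj_ofReal, h]
  linear_combination (-(s : ℂ) ^ 2 * inner ℂ (x : E) (y : E)) * Complex.I_sq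

theorem norm_sq_add_I_smul {H : E →ₗ.[ℂ] E} (hH : H.IsFormalAdjoint H) (s : ℝ) (x : H.domain) :
    ‖H x + (Complex.I * s) • (x : E)‖ ^ 2 = ‖H x‖ ^ 2 + s ^ 2 * ‖(x : E)‖ ^ 2 := by
  have h := inner_add_I_smul hH s x x
  simp only [inner_self_eq_norm_sq_to_K] at h
  simp only [Complex.coe_algebraMap] at h
  exact_mod_cast h

/-- The operator `H + i s` on the domain of `H`. -/
def shift (H : E →ₗ.[ℂ] E) (s : ℝ) : H.domain →ₗ[ℂ] E :=
  H.toFun + (Complex.I * s) • H.domain.subtype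

theorem shift_apply (H : E →ₗ.[ℂ] E) (s : ℝ) (x : H.domain) :
    H.shift s x = H x + (Complex.I * s) • (x : E) := rfl

theorem shift_injective {H : E →ₗ.[ℂ] E} (hH : H.IsFormalAdjoint H) {s : ℝ} (hs : s ≠ 0) :
    Function.Injective (H.shift s) := by
  rw [injective_iff_map_eq_zero]
  intro x hx
  have h := norm_sq_add_I_smul hH s x
  rw [← shift_apply, hx, norm_zero] at h
  have h1 : s ^ 2 * ‖(x : E)‖ ^ 2 = 0 := by
    have := sq_nonneg ‖H x‖
    have : 0 ≤ s ^ 2 * ‖(x : E)‖ ^ 2 := by positivity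
    linarith
  simpa [hs] using h1

/-- Since (H + is)y and (H - is)y have the same inner products against the corresponding vectors at
x, orthogonality to (D + is)φ turns into orthogonality to (D - is)φ. Surjectivity is needed for one
sign only. -/
theorem exists_cayley {F : Type*} [AddCommGroup F] [Module ℂ F] {H : E →ₗ.[ℂ] E}
    (hH : H.IsFormalAdjoint H) {s : ℝ} (hs : s ≠ 0) (hsurj : Function.Surjective (H.shift s))
    (J D : F →ₗ[ℂ] E) (hext : ∀ φ, ∃ x : H.domain, (x : E) = J φ ∧ H x = D φ) :
    ∃ W : (LinearMap.range (D + (Complex.I * s) • J))ᗮ →ₗ[ℂ]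
        (LinearMap.range (D + (Complex.I * (-s : ℝ)) • J))ᗮ, Function.Injective W := by
  let e := LinearEquiv.ofBijective (H.shift s) ⟨shift_injective hH hs, hsurj⟩
  let C : E →ₗ[ℂ] E := H.shift (-s) ∘ₗ e.symm.toLinearMap
  have hC : Function.Injective C :=
    (shift_injective hH (neg_ne_zero.2 hs)).comp e.symm.injective
  have hmem : ∀ u ∈ (LinearMap.range (D + (Complex.I * s) • J))ᗮ,
      C u ∈ (LinearMap.range (D + (Complex.I * (-s : ℝ)) • J))ᗮ := by
    intro u hu
    obtain ⟨x, rfl⟩ := e.surjective u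
    rw [Submodule.mem_orthogonal] at hu ⊢
    rintro _ ⟨φ, rfl⟩
    obtain ⟨y, hy, hy'⟩ := hext φ
    have h1 := hu _ ⟨φ, rfl⟩
    have h2 := inner_add_I_smul hH s y x
    have h3 := inner_add_I_smul hH (-s) y x
    have h4 : C (e x) = H.shift (-s) x := by simp [C]
    have h5 : e x = H.shift s x := rfl
    rw [h4]
    rw [h5] at h1
    simp only [LinearMap.add_apply, LinearMap.smul_apply, ← hy, ← hy', shift_apply] at h1 ⊢
    rw [h3, ← h1, h2]
    push_cast
    ring
  exact ⟨C.restrict hmem, fun u v huv => Subtype.ext (hC (congrArg Subtype.val huv))⟩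

variable [CompleteSpace E]

theorem _root_.IsSelfAdjoint.isFormalAdjoint {H : E →ₗ.[ℂ] E} (hH : IsSelfAdjoint H) :
    H.IsFormalAdjoint H := by
  have h := adjoint_isFormalAdjoint hH.dense_domain
  rwa [isSelfAdjoint_def.1 hH] at h

/-- The graph of H is complete, and the norm identity bounds both coordinates of a graph point (x,
Hx) by ‖Hx + isx‖, so (x, y) ↦ y + isx is antilipschitz on the graph. -/
theorem isClosed_range_shift {H : E →ₗ.[ℂ] E} (hH : H.IsFormalAdjoint H) (hcl : H.IsClosed)
    {s : ℝ} (hs : s ≠ 0) : _root_.IsClosed (LinearMap.range (H.shift s) : Set E) := by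
  let T : E × E →L[ℂ] E :=
    ContinuousLinearMap.snd ℂ E E + (Complex.I * s) • ContinuousLinearMap.fst ℂ E E
  have hcomp : CompleteSpace H.graph := hcl.completeSpace_coe
  have hT : AntilipschitzWith (max 1 ‖s‖₊⁻¹) (T ∘L H.graph.subtypeL) := by
    refine ContinuousLinearMap.antilipschitz_of_bound _ fun z => ?_
    obtain ⟨x, hx, hy⟩ := H.mem_graph_iff.1 z.2
    have key := norm_sq_add_I_smul hH s x
    rw [hx, hy] at key
    change ‖(z : E × E)‖ ≤ _ * ‖(z : E × E).2 + (Complex.I * s) • (z : E × E).1‖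
    set w := ‖(z : E × E).2 + (Complex.I * s) • (z : E × E).1‖
    have hw : 0 ≤ w := norm_nonneg _
    have hs' : 0 < |s| := abs_pos.2 hs
    rw [Prod.norm_def]
    refine max_le ?_ ?_
    · have h1 : |s| * ‖(z : E × E).1‖ ≤ w := by
        refine le_of_sq_le_sq ?_ hw
        rw [key, mul_pow, sq_abs]
        linarith [sq_nonneg ‖(z : E × E).2‖]
      calc ‖(z : E × E).1‖ ≤ |s|⁻¹ * w := by
            rw [le_inv_mul_iff₀ hs']; exact h1
        _ ≤ _ := by
            gcongr
            simp
    · have h1 : ‖(z : E × E).2‖ ≤ w := by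
        refine le_of_sq_le_sq ?_ hw
        rw [key]
        have : 0 ≤ s ^ 2 * ‖(z : E × E).1‖ ^ 2 := by positivity
        linarith
      calc ‖(z : E × E).2‖ ≤ 1 * w := by rwa [one_mul]
        _ ≤ _ := by
            gcongr
            simp
  have := hT.isClosed_range (T ∘L H.graph.subtypeL).uniformContinuous
  convert this using 1
  ext y
  constructor
  · rintro ⟨x, rfl⟩
    exact ⟨⟨(x, H x), H.mem_graph x⟩, rfl⟩
  · rintro ⟨z, rfl⟩
    obtain ⟨x, hx, hy⟩ := H.mem_graph_iff.1 z.2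
    refine ⟨x, ?_⟩
    rw [shift_apply, hx, hy]
    rfl

/-- A vector orthogonal to the closed range is an eigenvector of the adjoint, that is of H, with
eigenvalue is; this is excluded because H - is is injective. -/
theorem _root_.IsSelfAdjoint.shift_surjective {H : E →ₗ.[ℂ] E} (hH : IsSelfAdjoint H)
    {s : ℝ} (hs : s ≠ 0) : Function.Surjective (H.shift s) := by
  have hsym := hH.isFormalAdjoint
  have hcl := isClosed_range_shift hsym hH.isClosed hs
  have : CompleteSpace (LinearMap.range (H.shift s)) := hcl.completeSpace_coe
  rw [← LinearMap.range_eq_top, ← Submodule.orthogonal_eq_bot_iff, Submodule.eq_bot_iff]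
  intro y hy
  have hy' : ∀ x : H.domain, inner ℂ ((Complex.I * s) • y) (x : E) = inner ℂ y (H x) := by
    intro x
    have h := (Submodule.mem_orthogonal' _ _).1 hy _ ⟨x, rfl⟩
    rw [shift_apply, inner_add_right, inner_smul_right] at h
    rw [inner_smul_left, map_mul, Complex.conj_I, Complex.conj_ofReal]
    linear_combination -h
  have hmem : y ∈ H.adjoint.domain := mem_adjoint_domain_of_exists _ ⟨_, hy'⟩
  have hval : H.adjoint ⟨y, hmem⟩ = (Complex.I * s) • y :=
    adjoint_apply_eq hH.dense_domain _ hy'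
  have hgr : (y, (Complex.I * s) • y) ∈ H.graph := by
    rw [← isSelfAdjoint_def.1 hH, ← hval]
    exact mem_graph _ ⟨y, hmem⟩
  obtain ⟨x, hx, hHx⟩ := H.mem_graph_iff.1 hgr
  simp only at hx hHx
  have h0 : H.shift (-s) x = 0 := by
    rw [shift_apply, hx, hHx]
    simp
  have := shift_injective hsym (neg_ne_zero.2 hs) (h0.trans (H.shift (-s)).map_zero.symm)
  rw [← hx, this]
  rfl

end LinearPMap

end SymmetricOperators

/-! ### The generator of a unitary group -/

section UnitaryGroups

variable {E : Type*} [NormedAddCommGroup E] [InnerProductSpace ℂ E]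

/-- The infinitesimal generator `(1 / 2πi) d/dt` at `t = 0` of a family of operators. -/
def infinitesimalGenerator (U : ℝ → (E ≃ₗᵢ[ℂ] E)) : E →ₗ.[ℂ] E where
  domain :=
    { carrier := {f | DifferentiableAt ℝ (fun t => U t f) 0}
      add_mem' := fun {f g} hf hg => by
        have := DifferentiableAt.add hf hg
        simpa [Pi.add_def] using this
      zero_mem' := by simp
      smul_mem' := fun c f hf => by
        have := DifferentiableAt.const_smul hf c
        simpa [Pi.smul_def] using this }
  toFun :=
    { toFun := fun f => (1 / (2 * (Real.pi : ℂ) * Complex.I)) • deriv (fun t => U t (f : E)) 0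
      map_add' := fun f g => by
        have := deriv_add f.2 g.2
        simp only [Pi.add_def] at this
        simp [this]
      map_smul' := fun c f => by
        have := deriv_const_smul c f.2
        simp only [Pi.smul_def] at this
        simp [this, smul_comm c] }

theorem infinitesimalGenerator_apply {U : ℝ → (E ≃ₗᵢ[ℂ] E)}
    (f : (infinitesimalGenerator U).domain) {f' : E} (h : HasDerivAt (fun t => U t (f : E)) f' 0) :
    infinitesimalGenerator U f = (1 / (2 * (Real.pi : ℂ) * Complex.I)) • f' := by
  rw [← h.deriv]
  rfl

theorem infinitesimalGenerator_isFormalAdjoint {U : ℝ → (E ≃ₗᵢ[ℂ] E)}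
    (h0 : ∀ f, U 0 f = f) :
    (infinitesimalGenerator U).IsFormalAdjoint (infinitesimalGenerator U) := by
  rintro ⟨f, hf⟩ ⟨g, hg⟩
  have hf' := DifferentiableAt.hasDerivAt hf
  have hg' := DifferentiableAt.hasDerivAt hg
  rw [infinitesimalGenerator_apply ⟨f, hf⟩ hf', infinitesimalGenerator_apply ⟨g, hg⟩ hg']
  have h1 := hf'.inner ℂ hg'
  have h2 : (fun t => inner ℂ (U t f) (U t g)) = fun _ => inner ℂ f g := by
    funext t
    exact (U t).inner_map_map f g
  rw [h2] at h1
  have h3 := h1.unique (hasDerivAt_const 0 _)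
  simp only [h0] at h3
  simp only [inner_smul_left, inner_smul_right, map_div₀, map_mul, map_one, Complex.conj_I,
    Complex.conj_ofReal, map_ofNat]
  have h4 : inner ℂ (deriv (fun t => U t f) 0) g = -inner ℂ f (deriv (fun t => U t g) 0) := by
    linear_combination h3
  rw [h4]
  have := Real.pi_ne_zero
  field_simp

/-- The resolvent as a Laplace transform: f = ∫₀^∞ e^{-μr} U(r)g dr satisfies U(t)f = e^{μt} ∫_t^∞
e^{-μr} U(r)g dr, which can be differentiated explicitly. -/
theorem exists_hasDerivAt_eq_smul_sub [CompleteSpace E] {U : ℝ → (E ≃ₗᵢ[ℂ] E)}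
    (h0 : ∀ f, U 0 f = f) (hadd : ∀ s t f, U (s + t) f = U s (U t f))
    (hcont : ∀ f, Continuous fun t => U t f) {μ : ℝ} (hμ : 0 < μ) (g : E) :
    ∃ f, HasDerivAt (fun t => U t f) (μ • f - g) 0 := by
  let φ : ℝ → E := fun r => Real.exp (-μ * r) • U r g
  have hφc : Continuous φ := by
    have := hcont g
    fun_prop
  have hφi : IntegrableOn φ (Set.Ioi 0) := by
    refine ((exp_neg_integrableOn_Ioi 0 hμ).mul_const ‖g‖).mono'
      hφc.aestronglyMeasurable (.of_forall fun r => ?_)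
    simp [φ, norm_smul]
  refine ⟨∫ r in Set.Ioi 0, φ r, ?_⟩
  have hU : ∀ t, U t (∫ r in Set.Ioi 0, φ r) = Real.exp (μ * t) • ((∫ r in Set.Ioi 0, φ r) - ∫ r in (0 : ℝ)..t, φ r) := by
    intro t
    have h1 : U t (∫ r in Set.Ioi 0, φ r) = ∫ r in Set.Ioi 0, U t (φ r) :=
      ((U t).toContinuousLinearEquiv.toContinuousLinearMap.integral_comp_comm hφi).symm
    have h2 : ∀ r, U t (φ r) = Real.exp (μ * t) • φ (t + r) := by
      intro r
      have h3 : U t (φ r) = Real.exp (-μ * r) • U (t + r) g := by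
        rw [hadd]
        exact (U t).toLinearEquiv.toLinearMap.map_smul_of_tower _ _
      rw [h3]
      simp only [φ]
      rw [smul_smul, ← Real.exp_add]
      ring_nf
    have h4 : ∫ r in Set.Ioi 0, φ (t + r) = ∫ r in Set.Ioi t, φ r := by
      have := (measurePreserving_add_left volume t).setIntegral_preimage_emb
        (measurableEmbedding_addLeft t) φ (Set.Ioi t)
      simpa using this
    have h5 : IntegrableOn φ (Set.Ioi t) := by
      have : IntegrableOn φ (Set.Icc (min 0 t) (max 0 t)) := hφc.integrableOn_Icc
      refine (this.union hφi).mono_set fun x hx => ?_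
      rcases lt_or_ge 0 x with h | h
      · exact Or.inr h
      · exact Or.inl ⟨(min_le_right _ _).trans hx.le, h.trans (le_max_left _ _)⟩
    rw [h1, funext h2, integral_smul, h4, ← intervalIntegral.integral_interval_add_Ioi hφi h5,
      add_sub_cancel_left (∫ r in (0 : ℝ)..t, φ r)]
  have hder : HasDerivAt (fun t => Real.exp (μ * t) • ((∫ r in Set.Ioi 0, φ r) - ∫ r in (0 : ℝ)..t, φ r))
      (Real.exp (μ * 0) • (0 - φ 0) + (Real.exp (μ * 0) * (μ * 1)) •
        ((∫ r in Set.Ioi 0, φ r) - ∫ r in (0 : ℝ)..0, φ r)) 0 :=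
    (((hasDerivAt_id (0 : ℝ)).const_mul μ).exp).smul
      ((hasDerivAt_const (0 : ℝ) _).sub (hφc.integral_hasStrictDerivAt 0 0).hasDerivAt)
  rw [funext hU]
  convert hder using 1
  simp [φ, h0]
  abel

theorem infinitesimalGenerator_shift_surjective [CompleteSpace E] {U : ℝ → (E ≃ₗᵢ[ℂ] E)}
    (h0 : ∀ f, U 0 f = f) (hadd : ∀ s t f, U (s + t) f = U s (U t f))
    (hcont : ∀ f, Continuous fun t => U t f) {s : ℝ} (hs : s = 1 ∨ s = -1) :
    Function.Surjective ((infinitesimalGenerator U).shift s) := by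
  intro g
  have hpi := Real.pi_pos
  -- The equation (generator + is)f = g multiplied by 2πi, solved for the derivative.
  obtain ⟨f, hf⟩ : ∃ f, HasDerivAt (fun t => U t f)
      ((2 * Real.pi * s) • f + (2 * (Real.pi : ℂ) * Complex.I) • g) 0 := by
    rcases hs with rfl | rfl
    · obtain ⟨f, hf⟩ := exists_hasDerivAt_eq_smul_sub h0 hadd hcont (μ := 2 * Real.pi)
        (by positivity) (-(2 * (Real.pi : ℂ) * Complex.I) • g)
      refine ⟨f, ?_⟩
      convert hf using 1
      simp
    -- For s = -1 the Laplace integral is applied to the reversed group t ↦ U(-t).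
    · obtain ⟨f, hf⟩ := exists_hasDerivAt_eq_smul_sub (U := fun t => U (-t)) (by simpa using h0)
        (fun s t f => by rw [neg_add, hadd]) (fun f => (hcont f).comp continuous_neg)
        (μ := 2 * Real.pi) (by positivity) ((2 * (Real.pi : ℂ) * Complex.I) • g)
      refine ⟨f, ?_⟩
      have h1 : HasDerivAt (fun t => U (-t) f)
          ((2 * Real.pi) • f - (2 * (Real.pi : ℂ) * Complex.I) • g) (-(0 : ℝ)) := by rw [neg_zero]; exact hf
      have h2 := h1.scomp (0 : ℝ) (hasDerivAt_neg (0 : ℝ))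
      have h3 : (fun t => U (-t) f) ∘ Neg.neg = fun t => U t f := by
        funext t
        simp
      rw [h3] at h2
      convert h2 using 1
      module
  refine ⟨⟨f, hf.differentiableAt⟩, ?_⟩
  rw [LinearPMap.shift_apply, infinitesimalGenerator_apply ⟨f, hf.differentiableAt⟩ hf]
  change _ • _ + (Complex.I * s) • f = g
  have h2 : (Real.pi : ℂ) ≠ 0 := by exact_mod_cast hpi.ne'
  rw [← Complex.coe_smul (2 * Real.pi * s) f, smul_add, smul_smul, smul_smul]
  have h3 : 1 / (2 * (Real.pi : ℂ) * Complex.I) * ((2 * Real.pi * s : ℝ) : ℂ)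
      = -(Complex.I * s) := by
    push_cast
    field_simp
    rw [Complex.I_sq]
    ring
  have h4 : 1 / (2 * (Real.pi : ℂ) * Complex.I) * (2 * (Real.pi : ℂ) * Complex.I) = 1 := by
    field_simp
  rw [h3, h4]
  module

end UnitaryGroups

/-! ### Deficiency spaces of D -/

section DeficiencySpaces

variable {Ω : Opens ℝ}

/-- The map `φ ↦ (1 / 2πi) φ' + i s φ` from `C₀^∞(Ω)` to `L²(Ω)`. -/
def shiftedDiff (Ω : Opens ℝ) (s : ℝ) : 𝓓(Ω, ℂ) →ₗ[ℂ] L2 Ω :=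
  diffTest Ω + (Complex.I * s) • testToL2 Ω

theorem shiftedDiff_coeFn (s : ℝ) (φ : 𝓓(Ω, ℂ)) :
    (shiftedDiff Ω s φ : ℝ → ℂ) =ᵐ[volume.restrict (Ω : Set ℝ)] fun x =>
      (1 / (2 * (Real.pi : ℂ) * Complex.I)) *
        (deriv φ x - ((2 * Real.pi * s : ℝ) : ℂ) * φ x) := by
  have h1 : (diffTest Ω φ : ℝ → ℂ) =ᵐ[volume.restrict (Ω : Set ℝ)] diffFun φ :=
    (memLp_diffFun φ).coeFn_toLp
  have h2 : (testToL2 Ω φ : ℝ → ℂ) =ᵐ[volume.restrict (Ω : Set ℝ)] φ :=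
    (memLp_testFunction φ).coeFn_toLp
  have h3 := Lp.coeFn_add (diffTest Ω φ) ((Complex.I * s) • testToL2 Ω φ)
  have h4 := Lp.coeFn_smul (Complex.I * s) (testToL2 Ω φ)
  filter_upwards [h1, h2, h3, h4] with x h1 h2 h3 h4
  have h5 : (shiftedDiff Ω s φ : ℝ → ℂ) x =
    (diffTest Ω φ + (Complex.I * s) • testToL2 Ω φ : L2 Ω) x := rfl
  rw [h5, h3, Pi.add_apply, h4, Pi.smul_apply, h1, h2, diffFun, smul_eq_mul]
  have := Real.pi_ne_zero
  push_cast
  field_simp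
  rw [Complex.I_sq]
  ring

/-- With c = 2πs, e^{-cx}(φ' - cφ) is the derivative of e^{-cx}φ. Truncation to I keeps this smooth
because I is relatively clopen in Ω, so the integral vanishes. -/
theorem toLp_indicator_exp_mem_orthogonal {I : Set ℝ} (hI : IsOpen I) (hIΩ : I ⊆ Ω)
    (hcompl : IsOpen ((Ω : Set ℝ) \ I)) (s : ℝ)
    (hf : MemLp (I.indicator fun x => (Real.exp (-(2 * Real.pi * s) * x) : ℂ)) 2
      (volume.restrict (Ω : Set ℝ))) :
    hf.toLp _ ∈ (LinearMap.range (shiftedDiff Ω s))ᗮ := by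
  rw [Submodule.mem_orthogonal']
  rintro _ ⟨φ, rfl⟩
  set c : ℝ := 2 * Real.pi * s
  set k : ℂ := 1 / (2 * (Real.pi : ℂ) * Complex.I)
  let g : ℝ → ℂ := fun x => k * ((Real.exp (-c * x) : ℂ) * φ x)
  let g' : ℝ → ℂ := fun x => k * ((Real.exp (-c * x) : ℂ) * (deriv φ x - (c : ℂ) * φ x))
  have hφ : Continuous (φ : ℝ → ℂ) := φ.continuous
  have hφ' : Continuous (deriv (φ : ℝ → ℂ)) := φ.contDiff.continuous_deriv (by simp)
  have hg : ∀ x, HasDerivAt g (g' x) x := by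
    intro x
    have h1 : HasDerivAt (fun x : ℝ => (Real.exp (-c * x) : ℂ))
        ((Real.exp (-c * x) * (-c * 1) : ℝ) : ℂ) x :=
      (((hasDerivAt_id x).const_mul (-c)).exp).ofReal_comp
    have h2 := (h1.mul (differentiable_testFunction φ x).hasDerivAt).const_mul k
    refine h2.congr_deriv ?_
    change _ = k * ((Real.exp (-c * x) : ℂ) * (deriv φ x - (c : ℂ) * φ x))
    push_cast
    ring
  have hgi : Integrable g := by
    refine Continuous.integrable_of_hasCompactSupport (by fun_prop) ?_
    exact (φ.hasCompactSupport.mul_left).mul_left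
  have hgi' : Integrable g' := by
    refine Continuous.integrable_of_hasCompactSupport (by fun_prop) ?_
    exact ((φ.hasCompactSupport.deriv.sub φ.hasCompactSupport.mul_left).mul_left).mul_left
  have hgI : ∀ x, HasDerivAt (I.indicator g) (I.indicator g' x) x := by
    intro x
    by_cases hx : x ∈ I
    · rw [Set.indicator_of_mem hx]
      refine (hg x).congr_of_eventuallyEq ?_
      filter_upwards [hI.mem_nhds hx] with y hy
      rw [Set.indicator_of_mem hy]
    · rw [Set.indicator_of_notMem hx]
      refine (hasDerivAt_const x (0 : ℂ)).congr_of_eventuallyEq ?_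
      by_cases hxΩ : x ∈ (Ω : Set ℝ)
      · filter_upwards [hcompl.mem_nhds ⟨hxΩ, hx⟩] with y hy
        rw [Set.indicator_of_notMem hy.2]
      -- This case contains the endpoints of I: they lie off Ω, hence off the closed support of φ.
      · have : x ∉ tsupport φ := fun h => hxΩ (φ.tsupport_subset h)
        filter_upwards [(isClosed_tsupport _).isOpen_compl.mem_nhds this] with y hy
        have hy0 := image_eq_zero_of_notMem_tsupport hy
        simp [g, hy0]
  have h0 := integral_eq_zero_of_hasDerivAt_of_integrable hgI
    (hgi'.indicator hI.measurableSet) (hgi.indicator hI.measurableSet)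
  rw [L2.inner_def, ← h0, ← setIntegral_eq_integral_of_forall_compl_eq_zero (s := Ω)
    (fun x hx => Set.indicator_of_notMem (fun h => hx (hIΩ h)) _)]
  refine integral_congr_ae ?_
  filter_upwards [hf.coeFn_toLp, shiftedDiff_coeFn s φ] with x h1 h2
  rw [h1, h2, RCLike.inner_apply]
  by_cases hx : x ∈ I
  · simp only [Set.indicator_of_mem hx, g', Complex.conj_ofReal]
    ring
  · simp [Set.indicator_of_notMem hx]

theorem exists_primitive {h : ℝ → ℂ} (hh : ContDiff ℝ (⊤ : ℕ∞) h) {a b : ℝ}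
    (hsupp : Function.support h ⊆ Set.Icc a b) (hint : ∫ x, h x = 0) :
    ∃ F : ℝ → ℂ, ContDiff ℝ (⊤ : ℕ∞) F ∧ (∀ x, HasDerivAt F (h x) x) ∧
      Function.support F ⊆ Set.Icc a b := by
  have hder : ∀ x, HasDerivAt (fun x => ∫ y in a..x, h y) (h x) x := fun x =>
    (hh.continuous.integral_hasStrictDerivAt a x).hasDerivAt
  refine ⟨fun x => ∫ y in a..x, h y, ?_, hder, ?_⟩
  · rw [contDiff_infty_iff_deriv]
    refine ⟨fun x => (hder x).differentiableAt, ?_⟩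
    rwa [funext fun x => (hder x).deriv]
  · intro x hx
    by_contra hx'
    apply hx
    change ∫ y in a..x, h y = 0
    rcases lt_or_ge x a with hxa | hxa
    · have h1 : Set.EqOn h 0 (Set.uIoo a x) := by
        intro y hy
        rw [Set.uIoo_of_gt hxa] at hy
        by_contra h0
        exact absurd (hsupp h0).1 (not_le.2 hy.2)
      rw [intervalIntegral.integral_symm, intervalIntegral.integral_of_le hxa.le,
        integral_Ioc_eq_integral_Ioo,
        setIntegral_eq_zero_of_forall_eq_zero fun y hy => h1 (Set.uIoo_of_gt hxa ▸ hy), neg_zero]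
    · have hxb : b < x := by
        by_contra hb
        exact hx' ⟨hxa, not_lt.1 hb⟩
      have h1 : ∀ y, y ∉ Set.Icc a x → h y = 0 := by
        intro y hy
        by_contra h0
        exact hy ⟨(hsupp h0).1, (hsupp h0).2.trans hxb.le⟩
      rw [intervalIntegral.integral_of_le hxa, ← integral_Icc_eq_integral_Ioc,
        setIntegral_eq_integral_of_forall_compl_eq_zero h1, hint]

/-- Variation of constants: ψ = e^{cx}F with F' = e^{-cx}η solves ψ' - cψ = η, and the vanishing
integral is what makes F compactly supported. -/
theorem testToL2_mem_range_shiftedDiff {a b : ℝ} (hab : Set.Icc a b ⊆ Ω) (s : ℝ) (η : 𝓓(Ω, ℂ))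
    (hη : tsupport η ⊆ Set.Icc a b)
    (hint : ∫ x, (Real.exp (-(2 * Real.pi * s) * x) : ℂ) * η x = 0) :
    testToL2 Ω η ∈ LinearMap.range (shiftedDiff Ω s) := by
  set c : ℝ := 2 * Real.pi * s
  have hexp : ∀ c : ℝ, ContDiff ℝ (⊤ : ℕ∞) fun x : ℝ => (Real.exp (c * x) : ℂ) := fun c =>
    Complex.ofRealCLM.contDiff.comp (Real.contDiff_exp.comp (contDiff_const.mul contDiff_id))
  obtain ⟨F, hF, hF', hFs⟩ := exists_primitive ((hexp (-c)).mul η.contDiff)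
    (((Function.support_mul_subset_right _ _).trans subset_closure).trans hη) hint
  have hts : tsupport (fun x => (Real.exp (c * x) : ℂ) * F x) ⊆ Set.Icc a b :=
    closure_minimal ((Function.support_mul_subset_right _ _).trans hFs) isClosed_Icc
  let ψ : 𝓓(Ω, ℂ) := ⟨fun x => (Real.exp (c * x) : ℂ) * F x, (hexp c).mul hF,
    isCompact_Icc.of_isClosed_subset (isClosed_tsupport _) hts, hts.trans hab⟩
  have hψ : ∀ x, deriv ψ x = (c : ℂ) * ψ x + η x := by
    intro x
    have h1 : HasDerivAt (fun x : ℝ => (Real.exp (c * x) : ℂ))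
        ((Real.exp (c * x) * (c * 1) : ℝ) : ℂ) x :=
      (((hasDerivAt_id x).const_mul c).exp).ofReal_comp
    have h2 : HasDerivAt ψ _ x := h1.mul (hF' x)
    rw [h2.deriv]
    change _ = (c : ℂ) * ((Real.exp (c * x) : ℂ) * F x) + η x
    have h3 : (Real.exp (c * x) : ℂ) * (Real.exp (-c * x) : ℂ) = 1 := by
      rw [← Complex.ofReal_mul, ← Real.exp_add]
      simp
    push_cast at h3 ⊢
    linear_combination η x * h3
  refine ⟨(2 * (Real.pi : ℂ) * Complex.I) • ψ, ?_⟩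
  rw [map_smul]
  refine Lp.ext ?_
  have h2 : (testToL2 Ω η : ℝ → ℂ) =ᵐ[volume.restrict (Ω : Set ℝ)] η :=
    (memLp_testFunction η).coeFn_toLp
  filter_upwards [Lp.coeFn_smul (2 * (Real.pi : ℂ) * Complex.I) (shiftedDiff Ω s ψ),
    shiftedDiff_coeFn s ψ, h2] with x h1 h2 h3
  rw [h1, Pi.smul_apply, h2, h3, hψ, smul_eq_mul]
  have := Real.pi_ne_zero
  field_simp
  ring

theorem inner_testToL2_eq_zero {I : Set ℝ} (hI : I.OrdConnected) (hIΩ : I ⊆ Ω) {s : ℝ}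
    {u : L2 Ω} (hu : u ∈ (LinearMap.range (shiftedDiff Ω s))ᗮ) (η : 𝓓(Ω, ℂ))
    (hη : tsupport η ⊆ I)
    (hint : ∫ x, (Real.exp (-(2 * Real.pi * s) * x) : ℂ) * η x = 0) :
    inner ℂ (testToL2 Ω η) u = 0 := by
  rcases (tsupport η).eq_empty_or_nonempty with h | h
  · have : η = 0 := by
      ext x
      exact image_eq_zero_of_notMem_tsupport (by simp [h])
    simp [this]
  · have hK : IsCompact (tsupport η) := η.hasCompactSupport
    refine (Submodule.mem_orthogonal _ _).1 hu _ (testToL2_mem_range_shiftedDiff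
      (a := sInf (tsupport η)) (b := sSup (tsupport η)) ?_ s η ?_ hint)
    · exact (hI.out (hη (hK.sInf_mem h)) (hη (hK.sSup_mem h))).trans hIΩ
    · exact fun x hx => ⟨csInf_le hK.bddBelow hx, le_csSup hK.bddAbove hx⟩

/-- The function η - mρ has zero weighted integral, so u annihilates it. As a functional on test
functions in I, u is thus fixed by one number: the weak form of u being a multiple of the
exponential. -/
theorem inner_testToL2_eq_mul {I : Set ℝ} (hI : I.OrdConnected) (hIΩ : I ⊆ Ω) {s : ℝ}
    {u : L2 Ω} (hu : u ∈ (LinearMap.range (shiftedDiff Ω s))ᗮ) (η ρ : 𝓓(Ω, ℂ))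
    (hη : tsupport η ⊆ I) (hρ : tsupport ρ ⊆ I)
    (hint : ∫ x, (Real.exp (-(2 * Real.pi * s) * x) : ℂ) * ρ x = 1) :
    inner ℂ (testToL2 Ω η) u =
      (starRingEnd ℂ) (∫ x, (Real.exp (-(2 * Real.pi * s) * x) : ℂ) * η x) *
        inner ℂ (testToL2 Ω ρ) u := by
  set m := ∫ x, (Real.exp (-(2 * Real.pi * s) * x) : ℂ) * η x with hm
  have hint' : ∀ θ : 𝓓(Ω, ℂ),
      Integrable fun x => (Real.exp (-(2 * Real.pi * s) * x) : ℂ) * θ x := fun θ =>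
    Continuous.integrable_of_hasCompactSupport (by fun_prop) θ.hasCompactSupport.mul_left
  have hsub : tsupport (η - m • ρ : 𝓓(Ω, ℂ)) ⊆ I := by
    refine (tsupport_sub (η : ℝ → ℂ) (m • (ρ : ℝ → ℂ))).trans (Set.union_subset hη ?_)
    exact (tsupport_smul_subset_right (fun _ => m) (ρ : ℝ → ℂ)).trans hρ
  have h := inner_testToL2_eq_zero hI hIΩ hu (η - m • ρ) hsub (by
    have h1 : ∀ x, (Real.exp (-(2 * Real.pi * s) * x) : ℂ) * (η - m • ρ : 𝓓(Ω, ℂ)) x =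
        (Real.exp (-(2 * Real.pi * s) * x) : ℂ) * η x -
          m * ((Real.exp (-(2 * Real.pi * s) * x) : ℂ) * ρ x) := by
      intro x
      simp only [FunLike.coe_sub, FunLike.coe_smul, Pi.sub_apply, Pi.smul_apply, smul_eq_mul]
      ring
    rw [funext h1, integral_sub (hint' η) ((hint' ρ).const_mul m), integral_const_mul, hint, ← hm]
    ring)
  rw [map_sub, map_smul, inner_sub_left, inner_smul_left] at h
  exact sub_eq_zero.1 h

theorem exists_testFunction {I : Set ℝ} (hI : IsOpen I) (hne : I.Nonempty) (hIΩ : I ⊆ Ω) (c : ℝ) :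
    ∃ ρ : 𝓓(Ω, ℂ), tsupport ρ ⊆ I ∧ ∫ x, (Real.exp (-c * x) : ℂ) * ρ x = 1 := by
  obtain ⟨x₀, hx₀⟩ := hne
  obtain ⟨f, hfI, hfc, hfd, hf01, hfx⟩ :=
    exists_contDiff_tsupport_subset (n := (⊤ : ℕ∞)) (hI.mem_nhds hx₀)
  set M := ∫ x, Real.exp (-c * x) * f x
  have hM : 0 < M := by
    have := hfd.continuous
    refine Continuous.integral_pos_of_hasCompactSupport_nonneg_nonzero (x := x₀) (by fun_prop)
      hfc.mul_left (fun x => mul_nonneg (Real.exp_pos _).le (hf01 ⟨x, rfl⟩).1) ?_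
    rw [hfx, mul_one]
    exact (Real.exp_pos _).ne'
  have hts : tsupport (fun x => ((M⁻¹ * f x : ℝ) : ℂ)) ⊆ tsupport f :=
    closure_mono fun x hx h0 => hx (by simp [h0])
  refine ⟨⟨fun x => ((M⁻¹ * f x : ℝ) : ℂ),
    Complex.ofRealCLM.contDiff.comp (contDiff_const.mul hfd),
    hfc.of_isClosed_subset (isClosed_tsupport _) hts, (hts.trans hfI).trans hIΩ⟩,
    hts.trans hfI, ?_⟩
  have h1 : ∀ x, (Real.exp (-c * x) : ℂ) * ((M⁻¹ * f x : ℝ) : ℂ) =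
      ((M⁻¹ * (Real.exp (-c * x) * f x) : ℝ) : ℂ) := by
    intro x
    push_cast
    ring
  change ∫ x, (Real.exp (-c * x) : ℂ) * ((M⁻¹ * f x : ℝ) : ℂ) = 1
  rw [funext h1, integral_complex_ofReal, integral_const_mul, inv_mul_cancel₀ hM.ne', Complex.ofReal_one]

theorem eq_zero_of_inner_testToL2_eq_zero {ι : Type*} [Countable ι] {I : ι → Set ℝ}
    (hI : ∀ i, IsOpen (I i)) (hΩ : (Ω : Set ℝ) ⊆ ⋃ i, I i) (hIΩ : ∀ i, I i ⊆ Ω) {u : L2 Ω}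
    (h : ∀ i, ∀ η : 𝓓(Ω, ℂ), tsupport η ⊆ I i → inner ℂ (testToL2 Ω η) u = 0) : u = 0 := by
  have hloc : LocallyIntegrable (u : ℝ → ℂ) (volume.restrict (Ω : Set ℝ)) :=
    (Lp.memLp u).locallyIntegrable (by norm_num)
  have h1 : ∀ i, ∀ᵐ x ∂(volume.restrict (Ω : Set ℝ)), x ∈ I i → (u : ℝ → ℂ) x = 0 := by
    intro i
    refine (hI i).ae_eq_zero_of_integral_contDiff_smul_eq_zero (hloc.locallyIntegrableOn _) ?_
    intro g hg hgc hgs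
    have hts : tsupport (fun x => (g x : ℂ)) ⊆ tsupport g :=
      closure_mono fun x hx h0 => hx (by simp [h0])
    let η : 𝓓(Ω, ℂ) := ⟨fun x => (g x : ℂ), Complex.ofRealCLM.contDiff.comp hg,
      hgc.comp_left Complex.ofReal_zero, (hts.trans hgs).trans (hIΩ i)⟩
    rw [← h i η (hts.trans hgs), L2.inner_def]
    have h2 : (testToL2 Ω η : ℝ → ℂ) =ᵐ[volume.restrict (Ω : Set ℝ)] η :=
      (memLp_testFunction η).coeFn_toLp
    refine integral_congr_ae ?_
    filter_upwards [h2] with x hx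
    rw [hx, RCLike.inner_apply]
    change _ = _ * (starRingEnd ℂ) (g x : ℂ)
    rw [Complex.conj_ofReal, Complex.real_smul, mul_comm]
  refine Lp.eq_zero_iff_ae_eq_zero.2 ?_
  filter_upwards [ae_all_iff.2 h1, ae_restrict_mem Ω.isOpen.measurableSet] with x hx hxΩ
  obtain ⟨i, hi⟩ := Set.mem_iUnion.1 (hΩ hxΩ)
  exact hx i hi

/-- Here u would be a multiple of e^{2πτx}, which grows towards the infinite end. Test functions
pushed to infinity have weighted integral 1 while their norms tend to 0, so the multiple is 0. -/
theorem inner_testToL2_eq_zero_of_halfLine {a τ : ℝ} (hτ : τ = 1 ∨ τ = -1)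
    (hIΩ : {x : ℝ | a < τ * x} ⊆ Ω) {u : L2 Ω}
    (hu : u ∈ (LinearMap.range (shiftedDiff Ω (-τ)))ᗮ) (η : 𝓓(Ω, ℂ))
    (hη : tsupport η ⊆ {x : ℝ | a < τ * x}) : inner ℂ (testToL2 Ω η) u = 0 := by
  have hττ : τ * τ = 1 := by rcases hτ with rfl | rfl <;> norm_num
  have hIo : IsOpen {x : ℝ | a < τ * x} := isOpen_lt continuous_const (by fun_prop)
  have hIne : {x : ℝ | a < τ * x}.Nonempty := ⟨τ * (a + 1), by
    simp only [Set.mem_ofPred_eq]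
    rw [← mul_assoc, hττ]
    linarith⟩
  have hIc : {x : ℝ | a < τ * x}.OrdConnected := by
    refine ⟨fun x hx y hy z hz => ?_⟩
    simp only [Set.mem_ofPred_eq, Set.mem_Icc] at *
    rcases hτ with rfl | rfl <;> linarith
  obtain ⟨ρ, hρs, hρ⟩ := exists_testFunction hIo hIne hIΩ (2 * Real.pi * (-τ))
  have hsub : ∀ n : ℕ, tsupport (fun x => (Real.exp (-(2 * Real.pi) * n) : ℂ) * ρ (x - τ * n)) ⊆
      (fun x => x - τ * n) ⁻¹' tsupport ρ := fun n =>
    (tsupport_mul_subset_right ..).trans (tsupport_comp_subset_preimage ρ (by fun_prop))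
  have hsubI : ∀ n : ℕ, (fun x => x - τ * n) ⁻¹' tsupport ρ ⊆ {x : ℝ | a < τ * x} := by
    intro n x hx
    have h1 : a < τ * (x - τ * n) := hρs hx
    have h2 : (0 : ℝ) ≤ n := n.cast_nonneg
    have h3 : τ * (x - τ * n) = τ * x - n := by linear_combination (-(n : ℝ)) * hττ
    simp only [Set.mem_ofPred_eq]
    linarith
  -- The factor e^{-2πn} compensates the growth of e^{2πτx} under the shift by τn, because τ² = 1.
  let ρn : ℕ → 𝓓(Ω, ℂ) := fun n =>
    ⟨fun x => (Real.exp (-(2 * Real.pi) * n) : ℂ) * ρ (x - τ * n),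
      contDiff_const.mul (ρ.contDiff.comp (by fun_prop)),
      ((Homeomorph.subRight (τ * n)).isClosedEmbedding.isCompact_preimage
        ρ.hasCompactSupport).of_isClosed_subset (isClosed_tsupport _) (hsub n),
      ((hsub n).trans (hsubI n)).trans hIΩ⟩
  have hρn : ∀ n, ∫ x, (Real.exp (-(2 * Real.pi * (-τ)) * x) : ℂ) * ρn n x = 1 := by
    intro n
    rw [← hρ, ← integral_sub_right_eq_self
      (fun x => (Real.exp (-(2 * Real.pi * (-τ)) * x) : ℂ) * ρ x) (τ * n)]
    congr 1
    funext x
    change (_ : ℂ) * (_ * _) = _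
    rw [← mul_assoc, ← Complex.ofReal_mul, ← Real.exp_add]
    congr 3
    linear_combination (2 * Real.pi * n) * hττ
  have hnorm : ∀ n, ‖testToL2 Ω (ρn n)‖ ≤
      Real.exp (-(2 * Real.pi) * n) * (eLpNorm ρ 2 volume).toReal := by
    intro n
    have hρL : MemLp ρ 2 volume := ρ.continuous.memLp_of_hasCompactSupport ρ.hasCompactSupport
    have hmp := measurePreserving_sub_right (volume : Measure ℝ) (τ * n)
    have h1 : eLpNorm (ρn n) 2 (volume.restrict (Ω : Set ℝ)) ≤
        ENNReal.ofReal (Real.exp (-(2 * Real.pi) * n)) * eLpNorm ρ 2 volume := by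
      refine (eLpNorm_mono_measure _ Measure.restrict_le_self).trans ?_
      have h2 : (ρn n : ℝ → ℂ) = (Real.exp (-(2 * Real.pi) * n) : ℂ) •
          ((ρ : ℝ → ℂ) ∘ fun x => x - τ * n) := rfl
      rw [h2, eLpNorm_const_smul, eLpNorm_comp_measurePreserving hρL.1 hmp]
      gcongr
      rw [← ofReal_norm]
      gcongr
      rw [Complex.norm_real, Real.norm_of_nonneg (Real.exp_pos _).le]
    have h3 : ‖testToL2 Ω (ρn n)‖ = (eLpNorm (ρn n) 2 (volume.restrict (Ω : Set ℝ))).toReal :=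
      Lp.norm_toLp _ (memLp_testFunction (ρn n))
    rw [h3]
    refine (ENNReal.toReal_mono (ENNReal.mul_ne_top ENNReal.ofReal_ne_top hρL.2.ne) h1).trans ?_
    rw [ENNReal.toReal_mul, ENNReal.toReal_ofReal (Real.exp_pos _).le]
  set m := ∫ x, (Real.exp (-(2 * Real.pi * (-τ)) * x) : ℂ) * η x
  have hbound : ∀ n : ℕ, ‖inner ℂ (testToL2 Ω η) u‖ ≤
      ‖m‖ * (Real.exp (-(2 * Real.pi) * n) * (eLpNorm ρ 2 volume).toReal * ‖u‖) := by
    intro n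
    rw [inner_testToL2_eq_mul hIc hIΩ hu η (ρn n) hη ((hsub n).trans (hsubI n)) (hρn n),
      norm_mul, RCLike.norm_conj]
    gcongr
    exact (norm_inner_le_norm _ _).trans (by gcongr; exact hnorm n)
  have hlim : Filter.Tendsto (fun n : ℕ => ‖m‖ *
      (Real.exp (-(2 * Real.pi) * n) * (eLpNorm ρ 2 volume).toReal * ‖u‖)) Filter.atTop
      (𝓝 (‖m‖ * (0 * (eLpNorm ρ 2 volume).toReal * ‖u‖))) := by
    refine (((Real.tendsto_exp_atBot.comp ?_).mul_const _).mul_const _).const_mul _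
    exact tendsto_natCast_atTop_atTop.const_mul_atTop_of_neg (by linarith [Real.pi_pos])
  have := ge_of_tendsto' hlim hbound
  rw [zero_mul, zero_mul, mul_zero] at this
  exact norm_le_zero_iff.1 this

end DeficiencySpaces

/-! ### Comparing the two deficiency dimensions -/

section SymmetricExtensions

variable {Ω : Opens ℝ}

theorem memLp_indicator_exp {I : Set ℝ} (hI : IsOpen I) {c : ℝ}
    (h : IntegrableOn (fun x => Real.exp (-(2 * c) * x)) I) :
    MemLp (I.indicator fun x => (Real.exp (-c * x) : ℂ)) 2 (volume.restrict (Ω : Set ℝ)) := by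
  have h1 : MemLp (fun x => Real.exp (-c * x)) 2 (volume.restrict I) := by
    rw [memLp_two_iff_integrable_sq (by fun_prop)]
    refine h.congr (.of_forall fun x => ?_)
    simp only
    rw [← Real.exp_nat_mul]
    congr 1
    push_cast
    ring
  have h2 : MemLp (fun x => (Real.exp (-c * x) : ℂ)) 2 (volume.restrict I) := h1.ofReal
  have h3 := (memLp_indicator_iff_restrict hI.measurableSet).2 h2
  exact h3.mono_measure Measure.restrict_le_self

theorem integrableOn_exp_of_isBounded {I : Set ℝ} (h : Bornology.IsBounded I) (c : ℝ) :
    IntegrableOn (fun x => Real.exp (-c * x)) I := by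
  obtain ⟨r, hr⟩ := h.subset_closedBall 0
  have : Continuous fun x => Real.exp (-c * x) := by fun_prop
  exact (this.continuousOn.integrableOn_compact (isCompact_closedBall 0 r)).mono_set hr

theorem integrableOn_exp_halfLine {a τ : ℝ} (hτ : τ = 1 ∨ τ = -1) {k : ℝ} (hk : 0 < k) :
    IntegrableOn (fun x => Real.exp (-(k * τ) * x)) {x : ℝ | a < τ * x} := by
  rcases hτ with rfl | rfl
  · simpa [Set.Ioi] using exp_neg_integrableOn_Ioi a hk
  · refine IntegrableOn.mono_set (t := Set.Iic (-a)) ?_ fun x hx => ?_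
    · simpa using integrableOn_exp_mul_Iic hk (-a)
    · simp only [Set.mem_ofPred_eq] at hx
      simp only [Set.mem_Iic]
      linarith

theorem linearIndependent_toLp_indicator_exp {ι : Type*} {I : ι → Set ℝ}
    (hI : ∀ i, IsOpen (I i)) (hne : ∀ i, (I i).Nonempty) (hIΩ : ∀ i, I i ⊆ Ω)
    (hdisj : Pairwise fun i j => Disjoint (I i) (I j)) {c : ℝ}
    (hf : ∀ i, MemLp ((I i).indicator fun x => (Real.exp (-c * x) : ℂ)) 2
      (volume.restrict (Ω : Set ℝ))) :
    LinearIndependent ℂ fun i => ((hf i).toLp _ : L2 Ω) := by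
  refine linearIndependent_of_ne_zero_of_inner_eq_zero (fun i h0 => ?_) fun i j hij => ?_
  · have h1 := (hf i).coeFn_toLp.symm.trans (Lp.eq_zero_iff_ae_eq_zero.1 h0)
    have h2 : (volume.restrict (Ω : Set ℝ)) (I i) = 0 := by
      refine measure_mono_null (fun x hx => ?_) h1
      simpa using hx
    rw [Measure.restrict_apply (hI i).measurableSet, Set.inter_eq_left.2 (hIΩ i)] at h2
    exact ((hI i).measure_pos volume (hne i)).ne' h2
  · change inner ℂ _ _ = _
    rw [L2.inner_def]
    refine integral_eq_zero_of_ae ?_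
    filter_upwards [(hf i).coeFn_toLp, (hf j).coeFn_toLp] with x h1 h2
    rw [h1, h2]
    by_cases hx : x ∈ I i
    · rw [Set.indicator_of_notMem (Set.disjoint_left.1 (hdisj hij) hx)]
      simp
    · rw [Set.indicator_of_notMem hx]
      simp

theorem not_surjective_shift_of_isFormalAdjoint {ι : Type*} [Finite ι] {I : ι → Set ℝ}
    (hI : ∀ i, IsOpen (I i)) (hne : ∀ i, (I i).Nonempty) (hIc : ∀ i, (I i).OrdConnected)
    (hdisj : Pairwise fun i j => Disjoint (I i) (I j)) (hΩ : (Ω : Set ℝ) = ⋃ i, I i)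
    {i₀ : ι} {a τ : ℝ} (hτ : τ = 1 ∨ τ = -1) (hi₀ : I i₀ = {x : ℝ | a < τ * x})
    (hb : ∀ i ≠ i₀, Bornology.IsBounded (I i)) {H : L2 Ω →ₗ.[ℂ] L2 Ω}
    (hH : H.IsFormalAdjoint H) (hext : opD Ω ≤ H) :
    ¬ Function.Surjective (H.shift τ) := by
  classical
  intro hsurj
  have := Fintype.ofFinite ι
  have hIΩ : ∀ i, I i ⊆ Ω := fun i => hΩ ▸ Set.subset_iUnion I i
  have hτ0 : τ ≠ 0 := by rcases hτ with rfl | rfl <;> norm_num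
  obtain ⟨W, hW⟩ := LinearPMap.exists_cayley hH hτ0 hsurj (testToL2 Ω) (diffTest Ω) fun φ =>
    ⟨⟨testToL2 Ω φ, hext.1 (LinearMap.mem_range_self _ φ)⟩, rfl,
      (hext.2 (x := ⟨testToL2 Ω φ, LinearMap.mem_range_self _ φ⟩) rfl).symm.trans (opD_apply Ω φ)⟩
  have hf : ∀ i, MemLp ((I i).indicator fun x => (Real.exp (-(2 * Real.pi * τ) * x) : ℂ)) 2
      (volume.restrict (Ω : Set ℝ)) := by
    intro i
    refine memLp_indicator_exp (hI i) ?_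
    by_cases hi : i = i₀
    -- The constant is 4π because squaring e^{-2πτx} doubles its exponent.
    · have := integrableOn_exp_halfLine (a := a) hτ (k := 4 * Real.pi) (by positivity)
      rw [hi, hi₀]
      convert this using 4
      ring
    · exact integrableOn_exp_of_isBounded (hb i hi) _
  have hcompl : ∀ i, IsOpen ((Ω : Set ℝ) \ I i) := by
    intro i
    have : (Ω : Set ℝ) \ I i = ⋃ j ∈ {j | j ≠ i}, I j := by
      rw [hΩ]
      ext x
      simp only [Set.mem_sdiff, Set.mem_iUnion, Set.mem_ofPred_eq, exists_prop]
      constructor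
      · rintro ⟨⟨j, hj⟩, hi⟩
        exact ⟨j, fun h => hi (h ▸ hj), hj⟩
      · rintro ⟨j, hji, hj⟩
        exact ⟨⟨j, hj⟩, Set.disjoint_left.1 (hdisj hji) hj⟩
    rw [this]
    exact isOpen_biUnion fun j _ => hI j
  let v : ι → (LinearMap.range (shiftedDiff Ω τ))ᗮ := fun i =>
    ⟨(hf i).toLp _, toLp_indicator_exp_mem_orthogonal (hI i) (hIΩ i) (hcompl i) τ (hf i)⟩
  have hv : LinearIndependent ℂ v :=
    LinearIndependent.of_comp (Submodule.subtype _)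
      (linearIndependent_toLp_indicator_exp hI hne hIΩ hdisj hf)
  choose ρ hρs hρ using fun i : ι =>
    exists_testFunction (hI i) (hne i) (hIΩ i) (2 * Real.pi * (-τ))
  -- One coordinate per bounded interval: the pairing with a normalized test function there
  -- determines u on that interval, and u vanishes on the half-line.
  let L : (LinearMap.range (shiftedDiff Ω (-τ)))ᗮ →ₗ[ℂ] ({i // i ≠ i₀} → ℂ) :=
    LinearMap.pi fun i => innerₛₗ ℂ (testToL2 Ω (ρ i)) ∘ₗ Submodule.subtype _
  have hL : Function.Injective L := by
    rw [injective_iff_map_eq_zero]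
    intro u hu
    refine Subtype.ext (eq_zero_of_inner_testToL2_eq_zero hI hΩ.le hIΩ fun i η hη => ?_)
    by_cases hi : i = i₀
    · subst hi
      exact inner_testToL2_eq_zero_of_halfLine hτ (hi₀ ▸ hIΩ i) u.2 η (hi₀ ▸ hη)
    · have h0 : inner ℂ (testToL2 Ω (ρ i)) (u : L2 Ω) = 0 := congrFun hu ⟨i, hi⟩
      rw [inner_testToL2_eq_mul (hIc i) (hIΩ i) u.2 η (ρ i) hη (hρs i) (hρ i), h0, mul_zero]
  have hLW : Function.Injective (L ∘ₗ W) := hL.comp hW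
  have hcard := (hv.map' (L ∘ₗ W) (LinearMap.ker_eq_bot.2 hLW)).fintype_card_le_finrank
  rw [Module.finrank_fintype_fun_eq_card] at hcard
  exact absurd hcard (not_le.2 (Fintype.card_subtype_lt (x := i₀) (by simp)))

end SymmetricExtensions

/-! ### The integrability property makes the generator extend D -/

section IntegrabilityProperty

variable {Ω : Opens ℝ}

/-- The integrability property describes U(t)φ only near the support of φ. Unitarity does the rest:
the translate ψ already has the full norm of U(t)φ, so nothing is left elsewhere. The radius 2δ
leaves room to shift the δ-neighbourhood V by less than δ. -/
theorem eq_testToL2_of_hasIntegrabilityProperty {U : ℝ → (L2 Ω ≃ₗᵢ[ℂ] L2 Ω)}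
    (hU : HasIntegrabilityProperty U) (φ : 𝓓(Ω, ℂ)) {δ : ℝ}
    (hδ : Metric.thickening (δ + δ) (tsupport φ) ⊆ Ω) {t : ℝ} (ht : ‖t‖ < δ) :
    (U t (testToL2 Ω φ) : ℝ → ℂ) =ᵐ[volume.restrict (Ω : Set ℝ)] fun y => φ (y + t) := by
  rcases (tsupport φ).eq_empty_or_nonempty with hemp | ⟨x₀, hx₀⟩
  · have hφ : φ = 0 := by
      ext x
      exact image_eq_zero_of_notMem_tsupport (by simp [hemp])
    rw [hφ, map_zero, map_zero]
    exact Lp.coeFn_zero ..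
  have hδ0 : 0 < δ := (norm_nonneg t).trans_lt ht
  set V := Metric.thickening δ (tsupport φ)
  have hVt : ∀ t : ℝ, ‖t‖ < δ → ∀ y ∈ V, y + t ∈ (Ω : Set ℝ) := by
    intro t ht y hy
    refine hδ ?_
    rw [Metric.mem_thickening_iff] at hy ⊢
    obtain ⟨z, hz, hyz⟩ := hy
    refine ⟨z, hz, ?_⟩
    have h1 : dist (y + t) y = ‖t‖ := by simp
    linarith [dist_triangle (y + t) y z]
  have hVΩ : V ⊆ Ω := fun y hy => by simpa using hVt 0 (by simpa using hδ0) y hy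
  have hsub : (fun y => y + t) ⁻¹' tsupport φ ⊆ V := by
    intro y hy
    rw [Metric.mem_thickening_iff]
    exact ⟨y + t, hy, by simpa using ht⟩
  have hts : tsupport (fun y => φ (y + t)) ⊆ (fun y => y + t) ⁻¹' tsupport φ :=
    tsupport_comp_subset_preimage φ (by fun_prop)
  let ψ : 𝓓(Ω, ℂ) := ⟨fun y => φ (y + t), φ.contDiff.comp (by fun_prop),
    ((Homeomorph.addRight t).isClosedEmbedding.isCompact_preimage
      φ.hasCompactSupport).of_isClosed_subset (isClosed_tsupport _) hts,
    (hts.trans hsub).trans hVΩ⟩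
  have hcoe : ∀ θ : 𝓓(Ω, ℂ), (testToL2 Ω θ : ℝ → ℂ) =ᵐ[volume.restrict (Ω : Set ℝ)] θ :=
    fun θ => (memLp_testFunction θ).coeFn_toLp
  have hnorm : ∀ θ : 𝓓(Ω, ℂ), ‖testToL2 Ω θ‖ = (eLpNorm θ 2 volume).toReal := by
    intro θ
    rw [← eLpNorm_restrict_eq_of_support_subset (s := (Ω : Set ℝ))
      (subset_closure.trans θ.tsupport_subset)]
    exact Lp.norm_toLp _ (memLp_testFunction θ)
  have hnormψ : ‖testToL2 Ω ψ‖ = ‖U t (testToL2 Ω φ)‖ := by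
    rw [LinearIsometryEquiv.norm_map, hnorm, hnorm]
    have h1 : (ψ : ℝ → ℂ) = φ ∘ fun y => y + t := rfl
    rw [h1, eLpNorm_comp_measurePreserving φ.continuous.aestronglyMeasurable
      (measurePreserving_add_right volume t)]
  have hφt : ∀ᵐ y : ℝ, y + t ∈ (Ω : Set ℝ) → (testToL2 Ω φ : ℝ → ℂ) (y + t) = φ (y + t) :=
    (measurePreserving_add_right (volume : Measure ℝ) t).quasiMeasurePreserving.ae
      ((ae_restrict_iff' Ω.isOpen.measurableSet).1 (hcoe φ))
  have hinner : inner ℂ (testToL2 Ω ψ) (U t (testToL2 Ω φ)) =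
      inner ℂ (testToL2 Ω ψ) (testToL2 Ω ψ) := by
    rw [L2.inner_def, L2.inner_def]
    refine integral_congr_ae ?_
    filter_upwards [hcoe ψ, ae_restrict_of_ae hφt,
      ae_restrict_of_ae (hU x₀ (φ.tsupport_subset hx₀) V hVΩ
        (Metric.isOpen_thickening.mem_nhds (Metric.self_subset_thickening hδ0 _ hx₀)) δ hδ0 hVt t
        ht (testToL2 Ω φ))] with y h1 h2 h3
    rw [h1]
    by_cases hy : y ∈ V
    · rw [h3 hy, h2 (hVt t ht y hy)]
      rfl
    · have : ψ y = 0 := image_eq_zero_of_notMem_tsupport fun h => hy (hsub (hts h))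
      simp [this]
  -- Equal norms together with ⟨ψ, U(t)φ⟩ = ‖ψ‖² give ‖U(t)φ - ψ‖² = 0.
  have heq : U t (testToL2 Ω φ) = testToL2 Ω ψ := by
    rw [← sub_eq_zero, ← norm_eq_zero, ← sq_eq_zero_iff, norm_sub_sq (𝕜 := ℂ),
      ← inner_conj_symm, hinner, inner_conj_symm, inner_self_eq_norm_sq, hnormψ]
    ring
  rw [heq]
  exact hcoe ψ

/-- For small t the group translates φ, and since φ' is Lipschitz the first-order Taylor remainder
is at most C t² pointwise. It vanishes off a fixed compact K, so it is O(t²) in L². -/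
theorem hasDerivAt_of_hasIntegrabilityProperty {U : ℝ → (L2 Ω ≃ₗᵢ[ℂ] L2 Ω)}
    (h0 : ∀ f, U 0 f = f) (hU : HasIntegrabilityProperty U) (φ : 𝓓(Ω, ℂ)) :
    HasDerivAt (fun t => U t (testToL2 Ω φ))
      ((2 * (Real.pi : ℂ) * Complex.I) • diffTest Ω φ) 0 := by
  obtain ⟨ε, hε, hεΩ⟩ := φ.hasCompactSupport.exists_thickening_subset_open Ω.isOpen
    φ.tsupport_subset
  obtain ⟨C, hC⟩ := ContDiff.lipschitzWith_of_hasCompactSupport φ.hasCompactSupport.deriv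
    (contDiff_infty_iff_deriv.1 φ.contDiff).2 (by simp)
  set δ := ε / 2
  have hδ : 0 < δ := half_pos hε
  have hK : IsCompact (Metric.cthickening δ (tsupport φ)) :=
    IsCompact.cthickening φ.hasCompactSupport
  set K := Metric.cthickening δ (tsupport φ)
  have hKfin : (volume.restrict (Ω : Set ℝ)) K ≠ ⊤ :=
    ((Measure.restrict_apply_le _ _).trans_lt hK.measure_lt_top).ne
  let χ : L2 Ω := indicatorConstLp 2 hK.measurableSet hKfin (1 : ℂ)
  rw [hasDerivAt_iff_isLittleO_nhds_zero]
  have hO : (fun t => U (0 + t) (testToL2 Ω φ) - U 0 (testToL2 Ω φ) -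
      t • ((2 * (Real.pi : ℂ) * Complex.I) • diffTest Ω φ)) =O[𝓝 0] fun t : ℝ => t ^ 2 := by
    refine Asymptotics.IsBigO.of_bound (C * ‖χ‖) ?_
    filter_upwards [Metric.ball_mem_nhds (0 : ℝ) hδ] with t ht
    rw [mem_ball_zero_iff] at ht
    rw [zero_add, h0]
    have hle : ‖U t (testToL2 Ω φ) - testToL2 Ω φ -
        t • ((2 * (Real.pi : ℂ) * Complex.I) • diffTest Ω φ)‖ ≤ (C * ‖t‖ * ‖t‖) * ‖χ‖ := by
      refine Lp.norm_le_mul_norm_of_ae_le_mul ?_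
      have h2 : (testToL2 Ω φ : ℝ → ℂ) =ᵐ[volume.restrict (Ω : Set ℝ)] φ :=
        (memLp_testFunction φ).coeFn_toLp
      have h3 : (diffTest Ω φ : ℝ → ℂ) =ᵐ[volume.restrict (Ω : Set ℝ)] diffFun φ :=
        (memLp_diffFun φ).coeFn_toLp
      filter_upwards [eq_testToL2_of_hasIntegrabilityProperty hU φ
        (by rw [add_halves]; exact hεΩ) ht, h2, h3,
        Lp.coeFn_sub (U t (testToL2 Ω φ) - testToL2 Ω φ)
          (t • ((2 * (Real.pi : ℂ) * Complex.I) • diffTest Ω φ)),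
        Lp.coeFn_sub (U t (testToL2 Ω φ)) (testToL2 Ω φ),
        Lp.coeFn_smul t ((2 * (Real.pi : ℂ) * Complex.I) • diffTest Ω φ),
        Lp.coeFn_smul (2 * (Real.pi : ℂ) * Complex.I) (diffTest Ω φ),
        indicatorConstLp_coeFn (p := 2) (hs := hK.measurableSet) (hμs := hKfin) (c := (1 : ℂ))]
        with y h1 h2 h3 h4 h5 h6 h7 h8
      have hd : (2 * (Real.pi : ℂ) * Complex.I) * diffFun φ y = deriv φ y := by
        rw [diffFun]
        have := Real.pi_ne_zero
        field_simp
      rw [h4, Pi.sub_apply, h5, Pi.sub_apply, h6, Pi.smul_apply, h7, Pi.smul_apply, h1, h2, h3,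
        smul_eq_mul, hd]
      change _ ≤ _ * ‖(indicatorConstLp 2 hK.measurableSet hKfin (1 : ℂ) : ℝ → ℂ) y‖
      rw [h8]
      by_cases hy : y ∈ K
      · rw [Set.indicator_of_mem hy, norm_one, mul_one]
        have hder : ∀ r ∈ Metric.closedBall (0 : ℝ) ‖t‖, HasDerivWithinAt
            (fun r : ℝ => φ (y + r) - r • deriv φ y) (deriv φ (y + r) - (1 : ℝ) • deriv φ y)
            (Metric.closedBall (0 : ℝ) ‖t‖) r := fun r _ =>
          (((differentiable_testFunction φ (y + r)).hasDerivAt.comp_const_add y r).sub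
            ((hasDerivAt_id r).smul_const _)).hasDerivWithinAt
        have hbd : ∀ r ∈ Metric.closedBall (0 : ℝ) ‖t‖,
            ‖deriv φ (y + r) - (1 : ℝ) • deriv φ y‖ ≤ C * ‖t‖ := by
          intro r hr
          rw [one_smul, ← dist_eq_norm]
          refine (hC.dist_le_mul _ _).trans ?_
          gcongr
          simpa using hr
        have := (convex_closedBall (0 : ℝ) ‖t‖).norm_image_sub_le_of_norm_hasDerivWithin_le
          hder hbd (x := 0) (y := t) (by simp) (by simp)
        simp only [add_zero, zero_smul, sub_zero] at this
        convert this using 2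
        abel
      · have h9 : φ y = 0 := image_eq_zero_of_notMem_tsupport fun h =>
          hy (Metric.self_subset_cthickening _ h)
        have h10 : deriv φ y = 0 := image_eq_zero_of_notMem_tsupport fun h =>
          hy (Metric.self_subset_cthickening _ (tsupport_deriv_subset h))
        have h11 : φ (y + t) = 0 := image_eq_zero_of_notMem_tsupport fun h =>
          hy (Metric.mem_cthickening_of_dist_le y _ δ _ h (by simpa using ht.le))
        simp [h9, h10, h11, Set.indicator_of_notMem hy]
    refine hle.trans (le_of_eq ?_)
    rw [norm_pow]
    ring
  refine hO.trans_isLittleO ?_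
  simpa using Asymptotics.isLittleO_pow_id (𝕜 := ℝ) (n := 2) (by norm_num)

theorem opD_le_infinitesimalGenerator {U : ℝ → (L2 Ω ≃ₗᵢ[ℂ] L2 Ω)}
    (h0 : ∀ f, U 0 f = f) (hU : HasIntegrabilityProperty U) :
    opD Ω ≤ infinitesimalGenerator U := by
  refine ⟨?_, ?_⟩
  · rintro _ ⟨φ, rfl⟩
    exact (hasDerivAt_of_hasIntegrabilityProperty h0 hU φ).differentiableAt
  · rintro ⟨_, φ, rfl⟩ g hg
    have hg' : testToL2 Ω φ = g := hg
    have h1 := hasDerivAt_of_hasIntegrabilityProperty h0 hU φ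
    rw [hg'] at h1
    rw [infinitesimalGenerator_apply g h1, smul_smul]
    have := Real.pi_ne_zero
    have h2 : 1 / (2 * (Real.pi : ℂ) * Complex.I) * (2 * (Real.pi : ℂ) * Complex.I) = 1 := by
      field_simp
    rw [h2, one_smul]
    exact opD_apply Ω φ

end IntegrabilityProperty

/-! ### Reduction to a half-line and conclusion -/

theorem openInterval_eq_halfLine {a b : EReal} (hab : a < b)
    (hb : ¬ Bornology.IsBounded (openInterval a b : Set ℝ))
    (hne : (openInterval a b : Set ℝ) ≠ Set.univ) :
    ∃ r τ : ℝ, (τ = 1 ∨ τ = -1) ∧ (openInterval a b : Set ℝ) = {x : ℝ | r < τ * x} := by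
  have hmem : ∀ x : ℝ, x ∈ (openInterval a b : Set ℝ) ↔ a < x ∧ (x : EReal) < b := fun x => Iff.rfl
  induction a with
  | top => exact absurd hab not_top_lt
  | bot =>
    induction b with
    | bot => exact absurd hab (lt_irrefl _)
    | top =>
      refine absurd (Set.eq_univ_of_forall fun x => ?_) hne
      rw [hmem]
      exact ⟨EReal.bot_lt_coe x, EReal.coe_lt_top x⟩
    | coe b =>
      refine ⟨-b, -1, Or.inr rfl, ?_⟩
      ext x
      rw [hmem]
      simp
  | coe a =>
    induction b with
    | bot => exact absurd hab not_lt_bot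
    | top =>
      refine ⟨a, 1, Or.inl rfl, ?_⟩
      ext x
      rw [hmem]
      simp
    | coe b =>
      refine absurd ((Metric.isBounded_Icc a b).subset fun x hx => ?_) hb
      rw [hmem] at hx
      exact ⟨(EReal.coe_lt_coe_iff.1 hx.1).le, (EReal.coe_lt_coe_iff.1 hx.2).le⟩
end
theorem corollary4p4 {ι : Type*} [Finite ι] (α β : ι → EReal)
    (hlt : ∀ i, α i < β i)
    (hdisj : Pairwise fun i j =>
      Disjoint (openInterval (α i) (β i) : Set ℝ) (openInterval (α j) (β j) : Set ℝ))
    (hone : ∃! i, ¬ Bornology.IsBounded (openInterval (α i) (β i) : Set ℝ))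
    (hne : (unionIntervals α β : Set ℝ) ≠ Set.univ) :
    (¬ ∃ H : L2 (unionIntervals α β) →ₗ.[ℂ] L2 (unionIntervals α β),
        IsSelfAdjointExtension (unionIntervals α β) H) ∧
    (¬ ∃ U : ℝ → (L2 (unionIntervals α β) ≃ₗᵢ[ℂ] L2 (unionIntervals α β)),
        IsUnitaryGroup U ∧ HasIntegrabilityProperty U) := by
  obtain ⟨i₀, hi₀, huniq⟩ := hone
  have hΩ : (unionIntervals α β : Set ℝ) = ⋃ i, (openInterval (α i) (β i) : Set ℝ) :=
    Opens.coe_iSup _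
  -- The unbounded interval cannot be all of ℝ, since Ω would then be ℝ as well.
  obtain ⟨r, τ, hτ, hI₀⟩ := openInterval_eq_halfLine (hlt i₀) hi₀ fun h => hne <|
    Set.univ_subset_iff.1 (h ▸ hΩ ▸ Set.subset_iUnion
      (fun i => (openInterval (α i) (β i) : Set ℝ)) i₀)
  have hτ0 : τ ≠ 0 := by rcases hτ with rfl | rfl <;> norm_num
  have key : ∀ H : L2 (unionIntervals α β) →ₗ.[ℂ] L2 (unionIntervals α β),
      H.IsFormalAdjoint H → opD (unionIntervals α β) ≤ H → ¬ Function.Surjective (H.shift τ) := by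
    intro H hH hext
    refine not_surjective_shift_of_isFormalAdjoint (fun i => (openInterval (α i) (β i)).isOpen)
      (fun i => ?_) (fun i => ⟨fun x hx y hy z hz => ?_⟩) hdisj hΩ hτ hI₀
      (fun i hi => not_not.1 fun h => hi (huniq i h)) hH hext
    · obtain ⟨x, hx⟩ := EReal.lt_iff_exists_real_btwn.1 (hlt i)
      exact ⟨x, hx⟩
    · exact ⟨lt_of_lt_of_le hx.1 (EReal.coe_le_coe_iff.2 hz.1),
        lt_of_le_of_lt (EReal.coe_le_coe_iff.2 hz.2) hy.2⟩
  constructor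
  · rintro ⟨H, hext, hH⟩
    exact key H hH.isFormalAdjoint hext (hH.shift_surjective hτ0)
  · rintro ⟨U, hU, hint⟩
    exact key _ (infinitesimalGenerator_isFormalAdjoint hU.map_zero)
      (opD_le_infinitesimalGenerator hU.map_zero hint)
      (infinitesimalGenerator_shift_surjective hU.map_zero hU.map_add hU.continuous hτ)
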